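/- Let $n\ge 0$ and let $\mathbf U=(U_1,\dots,U_n)$ be a random vector with nonnegative components which is non-degenerate, i.e. its covariance matrix exists (each $U_i$ has finite second moment) and has full rank. Let $\mathbf Y=\mathcal P(\mathbf U)$ be the output of the vector Poisson channel with input $\mathbf U$: $\mathbf Y$ takes values in $\mathbb Z_+^n$ and, given $\mathbf U=\boldsymbol u$, its components are independent with $$P(\mathbf Y=\boldsymbol y\mid \mathbf U=\boldsymbol u)=\prod_{i=1}^n \frac{u_i^{y_i}e^{-u_i}}{y_i!},\qquad \boldsymbol y\in\mathbb Z_+^n \quad(0^0=1).$$ Then there exist a matrix $\mathsf H\in\mathbb R^{n\times n}$ and a vector $\boldsymbol c\in\mathbb R^n$ such that $$\mathbb E[\mathbf U\mid \mathbf Y=\boldsymbol y]=\mathsf H\boldsymbol y+\boldsymbol c\quad\text{for all }\boldsymbol y\in\mathbb Z^n_+\text{ with }P(\mathbf Y=\boldsymbol y)>0$$ if and only if there exist $\theta_i>0$, $\alpha_i>0$ ($1\le i\le n$) such that the law of $\mathbf U$ is the product $\prod_{i=1}^n \mathsf{Gam}(\theta_i,\alpha_i)$, where $\mathsf{Gam}(\theta,\alpha)$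 denotes the gamma distribution with rate $\theta$ and shape $\alpha$, whose density is $\frac{\theta^{\alpha}}{\Gamma(\alpha)}x^{\alpha-1}e^{-\theta x}$, $x\ge 0$. In this case, for any such $\mathsf H,\boldsymbol c,\theta_i,\alpha_i$, one has $P(\mathbf Y=\boldsymbol y)>0$ for every $\boldsymbol y\in\mathbb Z_+^n$ (so the affine formula holds for all $\boldsymbol y\in\mathbb Z^n_+$), the matrix $\mathsf H$ is diagonal with entries $h_{ii}=\frac{1}{1+\theta_i}$, and $c_i=\alpha_i h_{ii}=\frac{\alpha_i}{1+\theta_i}$; in particular $0<h_{ii}<1$ and $c_i>0$ for all $i$. -/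

import Mathlib

open MeasureTheory ProbabilityTheory

noncomputable section

namespace PoissonLinear

/-- The vector Poisson channel: for an input `u` with nonnegative entries, the output entries are
independent and the `i`-th one is Poisson with mean `u i`. -/
def poissonChannel (n : ℕ) : Kernel (Fin n → ℝ) (Fin n → ℕ) where
  toFun u := Measure.pi fun i => poissonMeasure (u i).toNNReal
  measurable' := by
    refine Measure.measurable_of_measurable_coe _ fun s _ => ?_
    have h : ∀ u : Fin n → ℝ, (Measure.pi fun i => poissonMeasure (u i).toNNReal) s =
        ∑' y : s, ∏ i, ENNReal.ofReal (Real.exp (-((u i).toNNReal : ℝ)) *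
          ((u i).toNNReal : ℝ) ^ ((y : Fin n → ℕ) i) / ((y : Fin n → ℕ) i).factorial) := by
      intro u
      rw [← Measure.tsum_indicator_apply_singleton _ s (Set.to_countable s).measurableSet,
        ← tsum_subtype s]
      refine tsum_congr fun y => ?_
      rw [Measure.pi_singleton]
      simp only [poissonMeasure_singleton]
    simp_rw [h]
    fun_prop

instance (n : ℕ) : IsMarkovKernel (poissonChannel n) :=
  ⟨fun u => inferInstanceAs
    (IsProbabilityMeasure (Measure.pi fun i => poissonMeasure (u i).toNNReal))⟩

variable {Ω : Type*} [MeasurableSpace Ω] {n : ℕ}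

/-- `Y` is the output of the Poisson channel with input `U`: the conditional law of `Y` given
`U = u` is `poissonChannel n u`. -/
def IsPoissonOutput (P : Measure Ω) (U : Ω → Fin n → ℝ) (Y : Ω → Fin n → ℕ) : Prop :=
  Measurable Y ∧ HasCondDistrib Y U (poissonChannel n) P

/-- The covariance matrix of the random vector `U`. -/
def covMatrix (P : Measure Ω) (U : Ω → Fin n → ℝ) : Matrix (Fin n) (Fin n) ℝ :=
  Matrix.of fun i j => covariance (fun ω => U ω i) (fun ω => U ω j) P

/-- `U` is non-degenerate: its covariance matrix exists and has full rank. -/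
def IsNondegenerate (P : Measure Ω) (U : Ω → Fin n → ℝ) : Prop :=
  (∀ i, MemLp (fun ω => U ω i) 2 P) ∧ (covMatrix P U).rank = n

/-- The conditional mean `E[U | Y = y]`, meaningful for those `y` with `P(Y = y) > 0`. -/
def condMean (P : Measure Ω) (U : Ω → Fin n → ℝ) (Y : Ω → Fin n → ℕ) (y : Fin n → ℕ) :
    Fin n → ℝ :=
  fun i => ∫ ω, U ω i ∂(ProbabilityTheory.cond P (Y ⁻¹' {y}))

/-- `E[U | Y = y] = H y + c` for all `y` at which the conditional mean is defined. -/
def HasAffineCondMean (P : Measure Ω) (U : Ω → Fin n → ℝ) (Y : Ω → Fin n → ℕ)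
    (H : Matrix (Fin n) (Fin n) ℝ) (c : Fin n → ℝ) : Prop :=
  ∀ y : Fin n → ℕ, P (Y ⁻¹' {y}) ≠ 0 →
    condMean P U Y y = H.mulVec (fun j => (y j : ℝ)) + c

/-- The law of `U` is the product over `i` of the gamma distributions with
rate `θ i > 0` and shape `α i > 0`. -/
def HasProductGammaLaw (P : Measure Ω) (U : Ω → Fin n → ℝ) (θ α : Fin n → ℝ) : Prop :=
  (∀ i, 0 < θ i ∧ 0 < α i) ∧
    P.map U = Measure.pi fun i => gammaMeasure (α i) (θ i)

end PoissonLinear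

end

/-! Let `ν` be the law of `U` given `Y = 0`, the tilt by `exp (-∑ i, u i)` of the law of `U`, and
let `M y` be its mixed moments. The Poisson likelihood makes `P (Y = y)` proportional to
`M y / ∏ i, (y i)!` and gives `E[U i | Y = y] = M (y + e_i) / M y`, so the conditional mean is
affine iff `M (y + e_i) = (H y + c)_i M y` for all `y` and `i`. The tilt provides exponential
moments, so `ν` is determined by `M`, hence by `H` and `c`. The recursion yields
`Cov ν = H diag(c)`, so non-degeneracy makes the rows of `H` linearly independent; comparing the two
orders of incrementing `y i` and `y j` gives a linear relation between rows `i` and `j` with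
coefficients `H j i` and `-H i j`, so `H` is diagonal. The recursion is then that of
`∏ i, Gam(1 / H i i, c i / H i i)`. Since `exp (u i)` is integrable under `ν`, the rates exceed `1`,
and undoing the tilt lowers each rate by `1`. -/

noncomputable section

namespace PoissonLinear

open Filter Topology Matrix

section MomentDeterminacy

variable {Ω Ω' : Type*} [MeasurableSpace Ω] [MeasurableSpace Ω'] {μ : Measure Ω} {μ' : Measure Ω'}

lemma complexMGF_eventuallyEq_of_moments_eq {X : Ω → ℝ} {Y : Ω' → ℝ}
    (hX : 0 ∈ interior (integrableExpSet X μ)) (hY : 0 ∈ interior (integrableExpSet Y μ'))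
    (h : ∀ k : ℕ, ∫ ω, X ω ^ k ∂μ = ∫ ω, Y ω ^ k ∂μ') :
    complexMGF X μ =ᶠ[𝓝 0] complexMGF Y μ' := by
  have hX' : (0 : ℂ).re ∈ interior (integrableExpSet X μ) := by simpa using hX
  have hY' : (0 : ℂ).re ∈ interior (integrableExpSet Y μ') := by simpa using hY
  have taylorCoeff_eq (k : ℕ) :
      iteratedDeriv k (complexMGF X μ) 0 = iteratedDeriv k (complexMGF Y μ') 0 := by
    rw [iteratedDeriv_complexMGF hX', iteratedDeriv_complexMGF hY']
    simp only [zero_mul, Complex.exp_zero, mul_one]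
    exact_mod_cast congrArg (fun x : ℝ => (x : ℂ)) (h k)
  have hXseries := (analyticAt_complexMGF hX').hasFPowerSeriesAt
  have hYseries := (analyticAt_complexMGF hY').hasFPowerSeriesAt
  simp only [taylorCoeff_eq] at hXseries
  filter_upwards [hXseries.eventually_hasSum_sub, hYseries.eventually_hasSum_sub] with z hXz hYz
  exact hXz.unique hYz

lemma complexMGF_I_eq_of_moments_eq {X : Ω → ℝ} {Y : Ω' → ℝ}
    (hX : 0 ∈ interior (integrableExpSet X μ)) (hY : 0 ∈ interior (integrableExpSet Y μ'))
    (h : ∀ k : ℕ, ∫ ω, X ω ^ k ∂μ = ∫ ω, Y ω ^ k ∂μ') :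
    complexMGF X μ Complex.I = complexMGF Y μ' Complex.I := by
  let strip : Set ℂ :=
    {z | z.re ∈ interior (integrableExpSet X μ) ∩ interior (integrableExpSet Y μ')}
  have hstrip : IsPreconnected strip :=
    ((convex_integrableExpSet.interior.inter convex_integrableExpSet.interior).linear_preimage
      Complex.reLm).isPreconnected
  exact AnalyticOnNhd.eqOn_of_preconnected_of_eventuallyEq (z₀ := 0)
    (fun _ hz => analyticAt_complexMGF hz.1) (fun _ hz => analyticAt_complexMGF hz.2) hstrip
    (by simpa [strip] using ⟨hX, hY⟩) (complexMGF_eventuallyEq_of_moments_eq hX hY h)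
    (by simpa [strip] using ⟨hX, hY⟩)

lemma zero_mem_interior_integrableExpSet_add {X Y : Ω → ℝ}
    (hX : 0 ∈ interior (integrableExpSet X μ)) (hY : 0 ∈ interior (integrableExpSet Y μ)) :
    0 ∈ interior (integrableExpSet (fun ω => X ω + Y ω) μ) := by
  have hXm := aemeasurable_of_mem_interior_integrableExpSet hX
  have hYm := aemeasurable_of_mem_interior_integrableExpSet hY
  rw [mem_interior_iff_mem_nhds] at hX hY ⊢
  have hdouble : Tendsto (fun t : ℝ => 2 * t) (𝓝 0) (𝓝 0) :=
    Continuous.tendsto' (by fun_prop) _ _ (by simp)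
  filter_upwards [hdouble hX, hdouble hY] with t hXt hYt
  refine (Integrable.add hXt hYt).mono' (by fun_prop) (ae_of_all _ fun ω => ?_)
  rw [Real.norm_eq_abs, Real.abs_exp]
  -- `exp (a + b) ≤ exp (2 a) + exp (2 b)`, since `a + b ≤ 2 max a b`.
  rcases le_total (t * X ω) (t * Y ω) with hle | hle
  · exact (Real.exp_le_exp.2 (by linarith)).trans (le_add_of_nonneg_left (Real.exp_pos _).le)
  · exact (Real.exp_le_exp.2 (by linarith)).trans (le_add_of_nonneg_right (Real.exp_pos _).le)

lemma zero_mem_interior_integrableExpSet_const_mul {X : Ω → ℝ}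
    (hX : 0 ∈ interior (integrableExpSet X μ)) (a : ℝ) :
    0 ∈ interior (integrableExpSet (fun ω => a * X ω) μ) := by
  rw [mem_interior_iff_mem_nhds] at hX ⊢
  have hscale : Tendsto (fun t : ℝ => t * a) (𝓝 0) (𝓝 0) :=
    Continuous.tendsto' (by fun_prop) _ _ (by simp)
  filter_upwards [hscale hX] with t ht
  simpa only [integrableExpSet, Set.mem_ofPred_eq, Set.mem_preimage, mul_assoc] using ht

lemma zero_mem_interior_integrableExpSet_sum [IsFiniteMeasure μ] {ι : Type*} (s : Finset ι)
    {X : ι → Ω → ℝ} (hX : ∀ i ∈ s, 0 ∈ interior (integrableExpSet (X i) μ)) :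
    0 ∈ interior (integrableExpSet (fun ω => ∑ i ∈ s, X i ω) μ) := by
  classical
  induction s using Finset.induction_on with
  | empty => simp [integrableExpSet]
  | insert i s hi ih =>
    simp_rw [Finset.sum_insert hi]
    exact zero_mem_interior_integrableExpSet_add (hX i (Finset.mem_insert_self i s))
      (ih fun j hj => hX j (Finset.mem_insert_of_mem hj))

lemma integrable_finsetProd_of_memLp_card [IsFiniteMeasure μ] {κ : Type*} {s : Finset κ}
    {f : κ → Ω → ℝ} (hf : ∀ k ∈ s, MemLp (f k) s.card μ) :
    Integrable (fun ω => ∏ k ∈ s, f k ω) μ := by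
  refine MemLp.integrable ?_ (MemLp.prod' hf)
  rw [ENNReal.one_le_inv, Finset.sum_const, nsmul_eq_mul]
  exact ENNReal.mul_inv_le_one _

end MomentDeterminacy

section MixedMoment

variable {ι : Type*} {ν ν' : Measure (ι → ℝ)}

/-- All coordinates have exponential moments under `ν`, on both sides of `0`. This is the
hypothesis under which `ν` is determined by its mixed moments. -/
def HasExpMoments (ν : Measure (ι → ℝ)) : Prop :=
  ∀ i, 0 ∈ interior (integrableExpSet (fun u : ι → ℝ => u i) ν)

lemma HasExpMoments.memLp (hν : HasExpMoments ν) (i : ι) (p : NNReal) :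
    MemLp (fun u : ι → ℝ => u i) p ν :=
  memLp_of_mem_interior_integrableExpSet (hν i) p

variable [Fintype ι]

/-- The mixed moment of `ν` of multi-index `y`. -/
def mixedMoment (ν : Measure (ι → ℝ)) (y : ι → ℕ) : ℝ :=
  ∫ u, ∏ i, u i ^ y i ∂ν

lemma HasExpMoments.integrable_prod_pow [IsFiniteMeasure ν] (hν : HasExpMoments ν) (y : ι → ℕ) :
    Integrable (fun u => ∏ i, u i ^ y i) ν := by
  have hprod (u : ι → ℝ) :
      ∏ i, u i ^ y i = ∏ k ∈ Finset.univ.sigma fun i => Finset.range (y i), u k.1 := by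
    simp only [Finset.prod_sigma, Finset.prod_const, Finset.card_range]
  simp_rw [hprod]
  exact integrable_finsetProd_of_memLp_card fun k _ => hν.memLp k.1 _

lemma HasExpMoments.zero_mem_interior_integrableExpSet_dotProduct [IsFiniteMeasure ν]
    (hν : HasExpMoments ν) (v : ι → ℝ) : 0 ∈ interior (integrableExpSet (fun u => v ⬝ᵥ u) ν) :=
  zero_mem_interior_integrableExpSet_sum _ fun i _ =>
    zero_mem_interior_integrableExpSet_const_mul (hν i) (v i)

lemma HasExpMoments.integral_dotProduct_pow [IsFiniteMeasure ν] (hν : HasExpMoments ν)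
    [DecidableEq ι] (v : ι → ℝ) (k : ℕ) :
    ∫ u, (v ⬝ᵥ u) ^ k ∂ν = ∑ y ∈ Finset.univ.piAntidiag k,
      (Nat.multinomial Finset.univ y * ∏ i, v i ^ y i) * mixedMoment ν y := by
  simp_rw [dotProduct, Finset.sum_pow_eq_sum_piAntidiag, mul_pow, Finset.prod_mul_distrib,
    ← mul_assoc, mixedMoment]
  rw [integral_finsetSum _ fun y _ => (hν.integrable_prod_pow y).const_mul _]
  simp_rw [integral_const_mul]

lemma HasExpMoments.ext_of_mixedMoment [IsFiniteMeasure ν] [IsFiniteMeasure ν']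
    (hν : HasExpMoments ν) (hν' : HasExpMoments ν') (h : mixedMoment ν = mixedMoment ν') :
    ν = ν' := by
  classical
  refine Measure.ext_of_charFunDual (funext fun L => ?_)
  let v : ι → ℝ := fun i => L (Pi.single i 1)
  have hL (u : ι → ℝ) : L u = v ⬝ᵥ u := by
    conv_lhs => rw [pi_eq_sum_univ' u, map_sum]
    simp only [map_smul, smul_eq_mul, dotProduct, v, mul_comm]
  have hmgf := complexMGF_I_eq_of_moments_eq (hν.zero_mem_interior_integrableExpSet_dotProduct v)
    (hν'.zero_mem_interior_integrableExpSet_dotProduct v) fun k => by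
      simp_rw [hν.integral_dotProduct_pow, hν'.integral_dotProduct_pow, h]
  simpa only [charFunDual_apply, complexMGF, hL, mul_comm Complex.I] using hmgf

end MixedMoment

section Gamma

variable {a r : ℝ}

lemma gammaMeasure_eq_withDensity_Ioi (a r : ℝ) :
    gammaMeasure a r = (volume.restrict (Set.Ioi 0)).withDensity (gammaPDF a r) := by
  rw [gammaMeasure, ← withDensity_indicator measurableSet_Ioi]
  refine withDensity_congr_ae ?_
  filter_upwards [Measure.ae_ne volume 0] with x hx
  rcases lt_or_gt_of_ne hx with hneg | hpos
  · rw [gammaPDF_of_neg hneg, Set.indicator_of_notMem (Set.notMem_Ioi.2 hneg.le)]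
  · rw [Set.indicator_of_mem (Set.mem_Ioi.2 hpos)]

lemma measurable_gammaPDF (a r : ℝ) : Measurable (gammaPDF a r) :=
  (measurable_gammaPDFReal a r).ennreal_ofReal

lemma toReal_gammaPDF (ha : 0 < a) (hr : 0 < r) {x : ℝ} (hx : 0 < x) :
    (gammaPDF a r x).toReal = r ^ a / Real.Gamma a * (x ^ (a - 1) * Real.exp (-(r * x))) := by
  rw [gammaPDF, ENNReal.toReal_ofReal (gammaPDFReal_nonneg ha hr x), gammaPDFReal, if_pos hx.le,
    mul_assoc]

lemma integral_gammaMeasure (ha : 0 < a) (hr : 0 < r) (f : ℝ → ℝ) :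
    ∫ x, f x ∂gammaMeasure a r =
      r ^ a / Real.Gamma a * ∫ x in Set.Ioi 0, x ^ (a - 1) * Real.exp (-(r * x)) * f x := by
  rw [gammaMeasure_eq_withDensity_Ioi, integral_withDensity_eq_integral_toReal_smul
    (measurable_gammaPDF a r) (ae_of_all _ fun _ => ENNReal.ofReal_lt_top), ← integral_const_mul]
  refine setIntegral_congr_fun measurableSet_Ioi fun x hx => ?_
  simp only [toReal_gammaPDF ha hr hx, smul_eq_mul, mul_assoc]

lemma integrable_gammaMeasure_iff (ha : 0 < a) (hr : 0 < r) {f : ℝ → ℝ} :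
    Integrable f (gammaMeasure a r) ↔
      IntegrableOn (fun x => x ^ (a - 1) * Real.exp (-(r * x)) * f x) (Set.Ioi 0) := by
  have hconst : IsUnit (r ^ a / Real.Gamma a) := by
    have := Real.Gamma_pos_of_pos ha
    exact IsUnit.mk0 _ (by positivity)
  rw [gammaMeasure_eq_withDensity_Ioi, integrable_withDensity_iff_integrable_smul'
    (measurable_gammaPDF a r) (ae_of_all _ fun _ => ENNReal.ofReal_lt_top), IntegrableOn,
    ← integrable_const_mul_iff hconst (fun x => x ^ (a - 1) * Real.exp (-(r * x)) * f x)]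
  refine integrable_congr ((ae_restrict_mem measurableSet_Ioi).mono fun x hx => ?_)
  simp only [toReal_gammaPDF ha hr hx, smul_eq_mul, mul_assoc]

lemma integral_pow_gammaMeasure (ha : 0 < a) (hr : 0 < r) (k : ℕ) :
    ∫ x, x ^ k ∂gammaMeasure a r =
      r ^ a / Real.Gamma a * ((1 / r) ^ (a + k) * Real.Gamma (a + k)) := by
  rw [integral_gammaMeasure ha hr, ← Real.integral_rpow_mul_exp_neg_mul_Ioi (by positivity) hr]
  congr 1
  refine setIntegral_congr_fun measurableSet_Ioi fun x (hx : 0 < x) => ?_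
  have hpow : x ^ (a + k - 1) = x ^ (a - 1) * x ^ k := by
    rw [← Real.rpow_natCast, ← Real.rpow_add hx, sub_add_eq_add_sub]
  simp only [hpow, mul_right_comm]

lemma integral_pow_gammaMeasure_pos (ha : 0 < a) (hr : 0 < r) (k : ℕ) :
    0 < ∫ x, x ^ k ∂gammaMeasure a r := by
  rw [integral_pow_gammaMeasure ha hr]
  positivity

lemma integral_pow_succ_gammaMeasure (ha : 0 < a) (hr : 0 < r) (k : ℕ) :
    ∫ x, x ^ (k + 1) ∂gammaMeasure a r = (a + k) / r * ∫ x, x ^ k ∂gammaMeasure a r := by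
  rw [integral_pow_gammaMeasure ha hr, integral_pow_gammaMeasure ha hr, Nat.cast_succ,
    ← add_assoc, Real.Gamma_add_one (by positivity), Real.rpow_add_one (by positivity)]
  ring

lemma rpow_mul_exp_neg_mul_exp (a r t x : ℝ) :
    x ^ (a - 1) * Real.exp (-(r * x)) * Real.exp (t * x) =
      x ^ (a - 1) * Real.exp (-((r - t) * x)) := by
  rw [mul_assoc, ← Real.exp_add]
  ring_nf

lemma integrableExpSet_id_gammaMeasure (ha : 0 < a) (hr : 0 < r) :
    integrableExpSet id (gammaMeasure a r) = Set.Iio r := by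
  ext t
  simp only [integrableExpSet, Set.mem_ofPred_eq, Set.mem_Iio, id,
    integrable_gammaMeasure_iff ha hr, rpow_mul_exp_neg_mul_exp]
  refine ⟨fun h => ?_, fun ht => ?_⟩
  · by_contra! ht
    refine not_integrableOn_Ioi_rpow (a - 1) (h.mono' (by fun_prop) ?_)
    refine (ae_restrict_mem measurableSet_Ioi).mono fun x (hx : 0 < x) => ?_
    rw [Real.norm_of_nonneg (by positivity)]
    refine le_mul_of_one_le_right (by positivity) (Real.one_le_exp ?_)
    nlinarith
  · simpa only [Real.rpow_one, neg_mul] using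
      integrableOn_rpow_mul_exp_neg_mul_rpow (by linarith) zero_lt_one (sub_pos.2 ht)

lemma mgf_id_gammaMeasure (ha : 0 < a) (hr : 0 < r) {t : ℝ} (ht : t < r) :
    mgf id (gammaMeasure a r) t = (r / (r - t)) ^ a := by
  have hrt := sub_pos.2 ht
  have := Real.Gamma_pos_of_pos ha
  simp only [mgf, id, integral_gammaMeasure ha hr, rpow_mul_exp_neg_mul_exp,
    Real.integral_rpow_mul_exp_neg_mul_Ioi ha hrt, Real.div_rpow hr.le hrt.le,
    Real.div_rpow zero_le_one hrt.le, Real.one_rpow]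
  field_simp

lemma gammaMeasure_tilted (ha : 0 < a) (hr : 0 < r) {t : ℝ} (ht : t < r) :
    (gammaMeasure a r).tilted (fun x => t * x) = gammaMeasure a (r - t) := by
  have hrt := sub_pos.2 ht
  have hmgf : ∫ x, Real.exp (t * x) ∂gammaMeasure a r = (r / (r - t)) ^ a :=
    mgf_id_gammaMeasure ha hr ht
  rw [Measure.tilted, hmgf, gammaMeasure, gammaMeasure,
    ← withDensity_mul _ (measurable_gammaPDF a r) (by fun_prop)]
  congr with x
  rw [Pi.mul_apply, gammaPDF, gammaPDF, ← ENNReal.ofReal_mul (gammaPDFReal_nonneg ha hr x)]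
  congr 1
  simp only [gammaPDFReal]
  split_ifs
  · rw [mul_div_assoc', mul_assoc (_ / _), mul_assoc (_ / _), rpow_mul_exp_neg_mul_exp,
      Real.div_rpow hr.le hrt.le]
    have := (Real.rpow_pos_of_pos hr a).ne'
    field_simp
  · exact zero_mul _

end Gamma

section ProductMeasure

variable {ι : Type*} [Fintype ι]

lemma pi_tilted {X : ι → Type*} [∀ i, MeasurableSpace (X i)] (μ : ∀ i, Measure (X i))
    [∀ i, SigmaFinite (μ i)] (f : ∀ i, X i → ℝ) :
    (Measure.pi μ).tilted (fun x => ∑ i, f i (x i)) = Measure.pi fun i => (μ i).tilted (f i) := by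
  refine (Measure.pi_eq fun s hs => ?_).symm
  simp_rw [tilted_apply_eq_ofReal_integral' _ (MeasurableSet.univ_pi hs),
    tilted_apply_eq_ofReal_integral' _ (hs _), Real.exp_sum,
    integral_fintype_prod_eq_prod fun i x => Real.exp (f i x), ← Finset.prod_div_distrib,
    Measure.restrict_pi_pi,
    integral_fintype_prod_eq_prod fun i x => Real.exp (f i x) / ∫ x, Real.exp (f i x) ∂μ i]
  exact ENNReal.ofReal_prod_of_nonneg fun i _ => integral_nonneg fun x => by positivity

lemma prod_add_single [DecidableEq ι] {M : Type*} [CommMonoid M] (f : ι → ℕ → M) (y : ι → ℕ)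
    (i : ι) {a : M} (h : f i (y i + 1) = a * f i (y i)) :
    ∏ j, f j ((y + Pi.single i 1 : ι → ℕ) j) = a * ∏ j, f j (y j) := by
  rw [← Finset.mul_prod_erase _ _ (Finset.mem_univ i),
    ← Finset.mul_prod_erase Finset.univ (fun j => f j (y j)) (Finset.mem_univ i), ← mul_assoc, ← h]
  congr 1
  · simp
  · refine Finset.prod_congr rfl fun j hj => ?_
    simp [Pi.single_eq_of_ne (Finset.ne_of_mem_erase hj)]

end ProductMeasure

section AffineMomentRecursion

variable {ι : Type*} [Fintype ι] {ν ν' : Measure (ι → ℝ)} {H H' : Matrix ι ι ℝ} {c c' : ι → ℝ}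

lemma mixedMoment_zero [IsProbabilityMeasure ν] : mixedMoment ν 0 = 1 := by
  simp [mixedMoment]

lemma mulVec_natCast_zero (H : Matrix ι ι ℝ) :
    H *ᵥ (fun j => ((0 : ι → ℕ) j : ℝ)) = 0 := by
  simp only [Pi.zero_apply, Nat.cast_zero, ← Pi.zero_def, mulVec_zero]

lemma mulVec_natCast_add_single [DecidableEq ι] (H : Matrix ι ι ℝ) (y : ι → ℕ) (k : ι) :
    H *ᵥ (fun j => ((y + Pi.single k 1 : ι → ℕ) j : ℝ)) = H *ᵥ (fun j => (y j : ℝ)) + H.col k := by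
  rw [← mulVec_single_one, ← mulVec_add]
  congr 1
  ext j
  rcases eq_or_ne j k with rfl | hjk
  · simp
  · simp [hjk]

lemma eq_and_eq_of_forall_natCast_mulVec_add_eq
    (h : ∀ y : ι → ℕ, H *ᵥ (fun j => (y j : ℝ)) + c = H' *ᵥ (fun j => (y j : ℝ)) + c') :
    H = H' ∧ c = c' := by
  classical
  have hc : c = c' := by simpa only [mulVec_natCast_zero, zero_add] using h 0
  refine ⟨ext_col fun k => ?_, hc⟩
  have hk := h (0 + Pi.single k 1)
  rwa [mulVec_natCast_add_single, mulVec_natCast_add_single, mulVec_natCast_zero,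
    mulVec_natCast_zero, zero_add, zero_add, hc, add_left_inj] at hk

variable [DecidableEq ι]

/-- The mixed moments of `ν` satisfy the first-order recursion with coefficients affine in the
multi-index: incrementing `y i` multiplies the moment by `(H y + c) i`. -/
def HasAffineMomentRecursion (ν : Measure (ι → ℝ)) (H : Matrix ι ι ℝ) (c : ι → ℝ) : Prop :=
  ∀ (y : ι → ℕ) (i : ι), mixedMoment ν (y + Pi.single i 1) =
    (H *ᵥ (fun j => (y j : ℝ)) + c) i * mixedMoment ν y

lemma prod_pow_add_single (u : ι → ℝ) (y : ι → ℕ) (i : ι) :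
    ∏ j, u j ^ (y + Pi.single i 1 : ι → ℕ) j = u i * ∏ j, u j ^ y j :=
  prod_add_single (fun j k => u j ^ k) y i (pow_succ' _ _)

lemma mixedMoment_zero_add_single (ν : Measure (ι → ℝ)) (i : ι) :
    mixedMoment ν (0 + Pi.single i 1) = ∫ u, u i ∂ν := by
  simp only [mixedMoment, prod_pow_add_single, Pi.zero_apply, pow_zero, Finset.prod_const_one,
    mul_one]

lemma mixedMoment_zero_add_single_add_single (ν : Measure (ι → ℝ)) (i j : ι) :
    mixedMoment ν (0 + Pi.single j 1 + Pi.single i 1) = ∫ u, u i * u j ∂ν := by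
  simp only [mixedMoment, prod_pow_add_single, Pi.zero_apply, pow_zero, Finset.prod_const_one,
    mul_one]

lemma HasAffineMomentRecursion.mixedMoment_eq [IsProbabilityMeasure ν] [IsProbabilityMeasure ν']
    (hν : HasAffineMomentRecursion ν H c) (hν' : HasAffineMomentRecursion ν' H c) :
    mixedMoment ν = mixedMoment ν' := by
  have hstep (y z : ι → ℕ) :
      mixedMoment ν z = mixedMoment ν' z → mixedMoment ν (z + y) = mixedMoment ν' (z + y) := by
    induction y using Pi.single_induction generalizing z with
    | zero => simp only [add_zero, imp_self]
    | add f g hf hg => exact fun h => by simpa only [add_assoc] using hg _ (hf _ h)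
    | single i m =>
      intro h
      induction m with
      | zero => simpa only [Pi.single_zero, add_zero] using h
      | succ m ih => rw [Pi.single_add, ← add_assoc, hν, hν', ih]
  funext y
  simpa only [zero_add] using hstep y 0 (by rw [mixedMoment_zero, mixedMoment_zero])

lemma HasAffineMomentRecursion.coeff_unique (hν : HasAffineMomentRecursion ν H c)
    (hν' : HasAffineMomentRecursion ν H' c') (hne : ∀ y, mixedMoment ν y ≠ 0) :
    H = H' ∧ c = c' :=
  eq_and_eq_of_forall_natCast_mulVec_add_eq fun y => funext fun i =>
    mul_right_cancel₀ (hne y) ((hν y i).symm.trans (hν' y i))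

end AffineMomentRecursion

section ProductGamma

variable {ι : Type*} [Fintype ι] {a r : ι → ℝ}

/-- The product of the gamma distributions with shapes `a i` and rates `r i`. -/
def piGamma (a r : ι → ℝ) : Measure (ι → ℝ) :=
  Measure.pi fun i => gammaMeasure (a i) (r i)

lemma isProbabilityMeasure_piGamma (ha : ∀ i, 0 < a i) (hr : ∀ i, 0 < r i) :
    IsProbabilityMeasure (piGamma a r) := by
  have := fun i => isProbabilityMeasure_gammaMeasure (ha i) (hr i)
  rw [piGamma]
  infer_instance

lemma piGamma_tilted (ha : ∀ i, 0 < a i) (hr : ∀ i, 0 < r i) {t : ι → ℝ} (ht : ∀ i, t i < r i) :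
    (piGamma a r).tilted (fun u => t ⬝ᵥ u) = piGamma a (r - t) := by
  have := fun i => isProbabilityMeasure_gammaMeasure (ha i) (hr i)
  have htilt := pi_tilted (fun i => gammaMeasure (a i) (r i)) fun i x => t i * x
  simp_rw [gammaMeasure_tilted (ha _) (hr _) (ht _)] at htilt
  exact htilt

lemma integrableExpSet_piGamma (ha : ∀ i, 0 < a i) (hr : ∀ i, 0 < r i) (i : ι) :
    integrableExpSet (fun u => u i) (piGamma a r) = Set.Iio (r i) := by
  have := fun i => isProbabilityMeasure_gammaMeasure (ha i) (hr i)
  rw [← integrableExpSet_id_gammaMeasure (ha i) (hr i)]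
  ext t
  exact (measurePreserving_eval _ i).integrable_comp (g := fun x => Real.exp (t * x)) (by fun_prop)

lemma hasExpMoments_piGamma (ha : ∀ i, 0 < a i) (hr : ∀ i, 0 < r i) :
    HasExpMoments (piGamma a r) := fun i => by
  simpa only [integrableExpSet_piGamma ha hr, interior_Iio, Set.mem_Iio] using hr i

lemma mixedMoment_piGamma (ha : ∀ i, 0 < a i) (hr : ∀ i, 0 < r i) (y : ι → ℕ) :
    mixedMoment (piGamma a r) y = ∏ i, ∫ x, x ^ y i ∂gammaMeasure (a i) (r i) := by
  have := fun i => isProbabilityMeasure_gammaMeasure (ha i) (hr i)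
  exact integral_fintype_prod_eq_prod fun i x => x ^ y i

lemma mixedMoment_piGamma_pos (ha : ∀ i, 0 < a i) (hr : ∀ i, 0 < r i) (y : ι → ℕ) :
    0 < mixedMoment (piGamma a r) y := by
  rw [mixedMoment_piGamma ha hr]
  exact Finset.prod_pos fun i _ => integral_pow_gammaMeasure_pos (ha i) (hr i) _

lemma hasAffineMomentRecursion_piGamma [DecidableEq ι] (ha : ∀ i, 0 < a i) (hr : ∀ i, 0 < r i) :
    HasAffineMomentRecursion (piGamma a r) (diagonal fun i => 1 / r i) (fun i => a i / r i) := by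
  intro y i
  have hcoeff : (diagonal (fun i => 1 / r i) *ᵥ (fun j => (y j : ℝ)) + fun i => a i / r i) i =
      (a i + y i) / r i := by
    rw [Pi.add_apply, mulVec_diagonal]
    ring
  rw [hcoeff, mixedMoment_piGamma ha hr, mixedMoment_piGamma ha hr]
  exact prod_add_single (fun j k => ∫ x, x ^ k ∂gammaMeasure (a j) (r j)) y i
    (integral_pow_succ_gammaMeasure (ha i) (hr i) _)

end ProductGamma

section AffineNondegeneracy

variable {ι : Type*} [Fintype ι] {μ ν : Measure (ι → ℝ)}

/-- `μ` is not carried by an affine hyperplane. In contrast to full rank of the covariance matrix,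
this is meaningful without second moments and depends only on the null sets of `μ`. -/
def IsAffinelyNondegenerate (μ : Measure (ι → ℝ)) : Prop :=
  ∀ (v : ι → ℝ) (k : ℝ), (∀ᵐ u ∂μ, v ⬝ᵥ u = k) → v = 0

lemma IsAffinelyNondegenerate.of_absolutelyContinuous (hμ : IsAffinelyNondegenerate μ)
    (hac : μ ≪ ν) : IsAffinelyNondegenerate ν :=
  fun v k hv => hμ v k (hac.ae_le hv)

lemma IsAffinelyNondegenerate.variance_dotProduct_pos [IsFiniteMeasure μ]
    (hμ : IsAffinelyNondegenerate μ) (hL2 : ∀ i, MemLp (fun u : ι → ℝ => u i) 2 μ) {v : ι → ℝ}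
    (hv : v ≠ 0) : 0 < Var[fun u => v ⬝ᵥ u; μ] := by
  have hvL2 : MemLp (fun u => v ⬝ᵥ u) 2 μ :=
    memLp_finsetSum _ fun i _ => (hL2 i).const_mul (v i)
  refine (variance_nonneg _ _).lt_of_ne fun h0 => hv ?_
  exact hμ v (∫ u, v ⬝ᵥ u ∂μ) (ae_eq_integral_of_variance_eq_zero hvL2 h0.symm)

lemma variance_dotProduct [IsFiniteMeasure μ] (hL2 : ∀ i, MemLp (fun u : ι → ℝ => u i) 2 μ)
    (v : ι → ℝ) : Var[fun u => v ⬝ᵥ u; μ] =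
      ∑ i, ∑ j, v i * v j * cov[fun u => u i, fun u => u j; μ] := by
  have hmul := fun i => (hL2 i).const_mul (v i)
  simp_rw [dotProduct]
  rw [variance_fun_sum hmul]
  simp_rw [covariance_const_mul_left, covariance_const_mul_right, mul_assoc]

end AffineNondegeneracy

namespace HasAffineMomentRecursion

variable {ι : Type*} [Fintype ι] [DecidableEq ι] {ν : Measure (ι → ℝ)} {H : Matrix ι ι ℝ}
  {c : ι → ℝ}

lemma integral_eq [IsProbabilityMeasure ν] (hrec : HasAffineMomentRecursion ν H c) (i : ι) :
    ∫ u, u i ∂ν = c i := by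
  rw [← mixedMoment_zero_add_single, hrec, mixedMoment_zero, mulVec_natCast_zero, zero_add, mul_one]

lemma covariance_eq [IsProbabilityMeasure ν] (hrec : HasAffineMomentRecursion ν H c)
    (hexp : HasExpMoments ν) (i j : ι) : cov[fun u => u i, fun u => u j; ν] = H i j * c j := by
  have hprod : ∫ u, u i * u j ∂ν = (H i j + c i) * c j := by
    rw [← mixedMoment_zero_add_single_add_single, hrec, mulVec_natCast_add_single,
      mulVec_natCast_zero, zero_add, mixedMoment_zero_add_single, hrec.integral_eq, Pi.add_apply,
      col_apply]
  rw [covariance_eq_sub (hexp.memLp i 2) (hexp.memLp j 2)]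
  simp only [Pi.mul_apply, hprod, hrec.integral_eq]
  ring

lemma variance_dotProduct [IsProbabilityMeasure ν] (hrec : HasAffineMomentRecursion ν H c)
    (hexp : HasExpMoments ν) (v : ι → ℝ) :
    Var[fun u => v ⬝ᵥ u; ν] = ∑ j, (v ᵥ* H) j * (v j * c j) := by
  rw [PoissonLinear.variance_dotProduct fun i => hexp.memLp i 2, Finset.sum_comm]
  simp_rw [hrec.covariance_eq hexp, vecMul, dotProduct, Finset.sum_mul]
  exact Finset.sum_congr rfl fun j _ => Finset.sum_congr rfl fun i _ => by ring

lemma eq_zero_of_vecMul_eq_zero [IsProbabilityMeasure ν] (hrec : HasAffineMomentRecursion ν H c)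
    (hexp : HasExpMoments ν) (hnd : IsAffinelyNondegenerate ν) {v : ι → ℝ} (hv : v ᵥ* H = 0) :
    v = 0 := by
  by_contra hne
  refine (hnd.variance_dotProduct_pos (fun i => hexp.memLp i 2) hne).ne' ?_
  rw [hrec.variance_dotProduct hexp, hv]
  simp only [Pi.zero_apply, zero_mul, Finset.sum_const_zero]

lemma coeff_pos [IsProbabilityMeasure ν] (hrec : HasAffineMomentRecursion ν H c)
    (hexp : HasExpMoments ν) (hnd : IsAffinelyNondegenerate ν)
    (hnn : ∀ᵐ u ∂ν, ∀ i, 0 ≤ u i) (i : ι) : 0 < H i i ∧ 0 < c i := by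
  have hvar : 0 < H i i * c i := by
    have := hnd.variance_dotProduct_pos (fun i => hexp.memLp i 2)
      (v := Pi.single i 1) (by simp)
    rw [hrec.variance_dotProduct hexp] at this
    simpa [Pi.single_apply] using this
  have hc : 0 ≤ c i := hrec.integral_eq i ▸ integral_nonneg_of_ae (hnn.mono fun u hu => hu i)
  exact ⟨pos_of_mul_pos_left hvar hc, hc.lt_of_ne' (right_ne_zero_of_mul hvar.ne')⟩

-- Compute `mixedMoment ν (y + e_i + e_j)` in the two possible orders.
lemma coeff_mul_comm (hrec : HasAffineMomentRecursion ν H c) {y : ι → ℕ}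
    (hy : mixedMoment ν y ≠ 0) (i j : ι) :
    H j i * (H *ᵥ (fun j => (y j : ℝ)) + c) i = H i j * (H *ᵥ (fun j => (y j : ℝ)) + c) j := by
  have horder : mixedMoment ν (y + Pi.single i 1 + Pi.single j 1) =
      mixedMoment ν (y + Pi.single j 1 + Pi.single i 1) := by rw [add_right_comm]
  rw [hrec, hrec, hrec, hrec, ← mul_assoc, ← mul_assoc, mul_left_inj' hy,
    mulVec_natCast_add_single, mulVec_natCast_add_single] at horder
  simp only [Pi.add_apply, col_apply] at horder ⊢
  linear_combination horder

lemma isDiag [IsProbabilityMeasure ν] (hrec : HasAffineMomentRecursion ν H c)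
    (hexp : HasExpMoments ν) (hnd : IsAffinelyNondegenerate ν)
    (hnn : ∀ᵐ u ∂ν, ∀ i, 0 ≤ u i) : H.IsDiag := by
  intro i j hij
  have hcomm0 := hrec.coeff_mul_comm (y := 0) (by simp [mixedMoment_zero]) i j
  rw [mulVec_natCast_zero, zero_add] at hcomm0
  have hcomm (k : ι) : H j i * H i k = H i j * H j k := by
    have hk : mixedMoment ν (0 + Pi.single k 1) ≠ 0 := by
      rw [mixedMoment_zero_add_single, hrec.integral_eq]
      exact (hrec.coeff_pos hexp hnd hnn k).2.ne'
    have := hrec.coeff_mul_comm hk i j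
    rw [mulVec_natCast_add_single, mulVec_natCast_zero, zero_add] at this
    simp only [Pi.add_apply, col_apply] at this
    linear_combination this - hcomm0
  have hker : (Pi.single i (H j i) - Pi.single j (H i j)) ᵥ* H = 0 := by
    ext k
    simp [sub_vecMul, hcomm]
  have hcoord := congrFun (hrec.eq_zero_of_vecMul_eq_zero hexp hnd hker) j
  simpa [hij.symm] using hcoord

theorem eq_piGamma [IsProbabilityMeasure ν] (hrec : HasAffineMomentRecursion ν H c)
    (hexp : HasExpMoments ν) (hnd : IsAffinelyNondegenerate ν)
    (hnn : ∀ᵐ u ∂ν, ∀ i, 0 ≤ u i) :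
    ν = piGamma (fun i => c i / H i i) (fun i => 1 / H i i) := by
  have hH i : 0 < H i i := (hrec.coeff_pos hexp hnd hnn i).1
  have hr i : 0 < 1 / H i i := one_div_pos.2 (hH i)
  have ha i : 0 < c i / H i i := div_pos (hrec.coeff_pos hexp hnd hnn i).2 (hH i)
  have := isProbabilityMeasure_piGamma ha hr
  have hgamma :
      HasAffineMomentRecursion (piGamma (fun i => c i / H i i) fun i => 1 / H i i) H c := by
    have hdiag : (diagonal fun i => H i i) = H :=
      (hrec.isDiag hexp hnd hnn).diagonal_diag
    have h := hasAffineMomentRecursion_piGamma ha hr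
    simp_rw [one_div_one_div, hdiag] at h
    convert h using 2 with i
    field_simp [(hH i).ne']
  exact hexp.ext_of_mixedMoment (hasExpMoments_piGamma ha hr) (hrec.mixedMoment_eq hgamma)

end HasAffineMomentRecursion

section ZeroOutputPosterior

variable {ι : Type*} [Fintype ι] {μ : Measure (ι → ℝ)}

/-- The law of an input of law `μ` to the Poisson channel given that the output is `0`, an event of
conditional probability `exp (-∑ i, u i)`. -/
def zeroOutputPosterior (μ : Measure (ι → ℝ)) : Measure (ι → ℝ) :=
  μ.tilted fun u => -1 ⬝ᵥ u

lemma integrable_exp_neg_one_dotProduct [IsFiniteMeasure μ] (hnn : ∀ᵐ u ∂μ, ∀ i, 0 ≤ u i) :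
    Integrable (fun u : ι → ℝ => Real.exp (-1 ⬝ᵥ u)) μ := by
  refine Integrable.of_bound (by fun_prop) 1 (hnn.mono fun u hu => ?_)
  rw [Real.norm_eq_abs, Real.abs_exp, Real.exp_le_one_iff, neg_dotProduct, one_dotProduct]
  exact neg_nonpos.2 (Finset.sum_nonneg fun i _ => hu i)

lemma isProbabilityMeasure_zeroOutputPosterior [IsProbabilityMeasure μ]
    (hnn : ∀ᵐ u ∂μ, ∀ i, 0 ≤ u i) : IsProbabilityMeasure (zeroOutputPosterior μ) :=
  isProbabilityMeasure_tilted (integrable_exp_neg_one_dotProduct hnn)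

lemma zeroOutputPosterior_tilted_one [IsProbabilityMeasure μ] (hnn : ∀ᵐ u ∂μ, ∀ i, 0 ≤ u i) :
    (zeroOutputPosterior μ).tilted (fun u => 1 ⬝ᵥ u) = μ := by
  have hneg : (fun u : ι → ℝ => 1 ⬝ᵥ u) = -fun u => -1 ⬝ᵥ u := by
    ext u
    rw [Pi.neg_apply, neg_dotProduct, neg_neg]
  rw [hneg]
  exact tilted_neg_same (integrable_exp_neg_one_dotProduct hnn)

lemma zeroOutputPosterior_piGamma {a r : ι → ℝ} (ha : ∀ i, 0 < a i) (hr : ∀ i, 0 < r i) :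
    zeroOutputPosterior (piGamma a r) = piGamma a (1 + r) := by
  rw [zeroOutputPosterior, piGamma_tilted ha hr (t := -1) fun i => neg_one_lt_zero.trans (hr i),
    sub_neg_eq_add, add_comm]

lemma ae_nonneg_zeroOutputPosterior (hnn : ∀ᵐ u ∂μ, ∀ i, 0 ≤ u i) :
    ∀ᵐ u ∂zeroOutputPosterior μ, ∀ i, 0 ≤ u i :=
  (tilted_absolutelyContinuous μ _).ae_le hnn

lemma IsAffinelyNondegenerate.zeroOutputPosterior [IsFiniteMeasure μ]
    (hnd : IsAffinelyNondegenerate μ) (hnn : ∀ᵐ u ∂μ, ∀ i, 0 ≤ u i) :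
    IsAffinelyNondegenerate (zeroOutputPosterior μ) :=
  hnd.of_absolutelyContinuous
    (absolutelyContinuous_tilted (integrable_exp_neg_one_dotProduct hnn))

lemma Iic_one_subset_integrableExpSet_zeroOutputPosterior [IsFiniteMeasure μ]
    (hnn : ∀ᵐ u ∂μ, ∀ i, 0 ≤ u i) (i : ι) :
    Set.Iic 1 ⊆ integrableExpSet (fun u => u i) (zeroOutputPosterior μ) := by
  intro t ht
  rw [integrableExpSet, Set.mem_ofPred_eq, zeroOutputPosterior,
    integrable_tilted_iff (integrable_exp_neg_one_dotProduct hnn)]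
  refine Integrable.of_bound (by fun_prop) 1 (hnn.mono fun u hu => ?_)
  have hle : t * u i ≤ 1 ⬝ᵥ u := by
    rw [one_dotProduct]
    exact (mul_le_of_le_one_left (hu i) ht).trans
      (Finset.single_le_sum (fun j _ => hu j) (Finset.mem_univ i))
  rw [smul_eq_mul, ← Real.exp_add, Real.norm_eq_abs, Real.abs_exp, Real.exp_le_one_iff,
    neg_dotProduct]
  linarith

lemma hasExpMoments_zeroOutputPosterior [IsFiniteMeasure μ] (hnn : ∀ᵐ u ∂μ, ∀ i, 0 ≤ u i) :
    HasExpMoments (zeroOutputPosterior μ) := fun i =>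
  interior_mono (Iic_one_subset_integrableExpSet_zeroOutputPosterior hnn i)
    (by simp only [interior_Iic, Set.mem_Iio, zero_lt_one])

theorem exists_eq_piGamma_of_hasAffineMomentRecursion_zeroOutputPosterior [DecidableEq ι]
    [IsProbabilityMeasure μ] {H : Matrix ι ι ℝ} {c : ι → ℝ} (hnn : ∀ᵐ u ∂μ, ∀ i, 0 ≤ u i)
    (hnd : IsAffinelyNondegenerate μ)
    (hrec : HasAffineMomentRecursion (zeroOutputPosterior μ) H c) :
    ∃ a r : ι → ℝ, (∀ i, 0 < a i) ∧ (∀ i, 0 < r i) ∧ μ = piGamma a r := by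
  have := isProbabilityMeasure_zeroOutputPosterior hnn
  have hexp := hasExpMoments_zeroOutputPosterior hnn
  have hnd' := hnd.zeroOutputPosterior hnn
  have hnn' := ae_nonneg_zeroOutputPosterior hnn
  have hpos := hrec.coeff_pos hexp hnd' hnn'
  have ha i : 0 < c i / H i i := div_pos (hpos i).2 (hpos i).1
  have hr i : 0 < 1 / H i i := one_div_pos.2 (hpos i).1
  have hgamma := hrec.eq_piGamma hexp hnd' hnn'
  -- The posterior integrates `exp (u i)`, so its rate in the `i`-th coordinate exceeds `1`.
  have hrate i : 1 < 1 / H i i := by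
    have hmem := Iic_one_subset_integrableExpSet_zeroOutputPosterior hnn i Set.self_mem_Iic
    rwa [hgamma, integrableExpSet_piGamma ha hr] at hmem
  refine ⟨_, _, ha, fun i => sub_pos.2 (hrate i), ?_⟩
  rw [← zeroOutputPosterior_tilted_one hnn, hgamma, piGamma_tilted ha hr (t := 1) hrate]
  rfl

end ZeroOutputPosterior

lemma map_restrict_preimage_of_hasCondDistrib {Ω 𝓧 𝓨 : Type*} [MeasurableSpace Ω]
    [MeasurableSpace 𝓧] [MeasurableSpace 𝓨] {P : Measure Ω} [SFinite P] {X : Ω → 𝓧} {Y : Ω → 𝓨}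
    {κ : Kernel 𝓧 𝓨} [IsSFiniteKernel κ] (hX : Measurable X) (hY : Measurable Y)
    (h : HasCondDistrib Y X κ P) {t : Set 𝓨} (ht : MeasurableSet t) :
    (P.restrict (Y ⁻¹' t)).map X = (P.map X).withDensity fun x => κ x t := by
  ext s hs
  rw [Measure.map_apply hX hs, Measure.restrict_apply (hX hs), withDensity_apply _ hs,
    ← Measure.compProd_apply_prod hs ht, ← h.map_eq,
    Measure.map_apply (hX.prodMk hY) (hs.prod ht), Set.mk_preimage_prod]

section Channel

variable {Ω : Type*} [MeasurableSpace Ω] {P : Measure Ω} {n : ℕ} {U : Ω → Fin n → ℝ}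
  {Y : Ω → Fin n → ℕ} {H : Matrix (Fin n) (Fin n) ℝ} {c : Fin n → ℝ}

lemma ae_nonneg_map (hU : Measurable U) (hU0 : ∀ᵐ ω ∂P, ∀ i, 0 ≤ U ω i) :
    ∀ᵐ u ∂P.map U, ∀ i, 0 ≤ u i :=
  (ae_map_iff hU.aemeasurable (by measurability)).2 hU0

lemma poissonChannel_real_singleton {u : Fin n → ℝ} (hu : ∀ i, 0 ≤ u i) (y : Fin n → ℕ) :
    (poissonChannel n u).real {y} =
      Real.exp (-1 ⬝ᵥ u) * (∏ i, u i ^ y i) / ∏ i, ((y i).factorial : ℝ) := by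
  change (Measure.pi fun i => poissonMeasure (u i).toNNReal).real {y} = _
  rw [measureReal_def, Measure.pi_singleton, ENNReal.toReal_prod, neg_dotProduct, one_dotProduct,
    ← Finset.sum_neg_distrib, Real.exp_sum, ← Finset.prod_mul_distrib, ← Finset.prod_div_distrib]
  refine Finset.prod_congr rfl fun i _ => ?_
  rw [poissonMeasure_singleton, ENNReal.toReal_ofReal (by positivity), Real.coe_toNNReal _ (hu i)]

lemma IsPoissonOutput.setIntegral_preimage_singleton [IsProbabilityMeasure P] (hU : Measurable U)
    (hU0 : ∀ᵐ ω ∂P, ∀ i, 0 ≤ U ω i) (hY : IsPoissonOutput P U Y) {f : (Fin n → ℝ) → ℝ}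
    (hf : Measurable f) (y : Fin n → ℕ) :
    ∫ ω in Y ⁻¹' {y}, f (U ω) ∂P =
      (∫ u, Real.exp (-1 ⬝ᵥ u) ∂P.map U) / (∏ i, ((y i).factorial : ℝ)) *
        ∫ u, f u * ∏ i, u i ^ y i ∂zeroOutputPosterior (P.map U) := by
  have hnn := ae_nonneg_map hU hU0
  have := Measure.isProbabilityMeasure_map (μ := P) hU.aemeasurable
  have hZ := (integral_exp_pos (integrable_exp_neg_one_dotProduct hnn)).ne'
  rw [← integral_map hU.aemeasurable hf.aestronglyMeasurable,
    map_restrict_preimage_of_hasCondDistrib hU hY.1 hY.2 (measurableSet_singleton y),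
    integral_withDensity_eq_integral_toReal_smul
      (Kernel.measurable_coe _ (measurableSet_singleton y))
      (ae_of_all _ fun _ => measure_lt_top _ _),
    zeroOutputPosterior, integral_tilted, ← integral_const_mul]
  refine integral_congr_ae (hnn.mono fun u hu => ?_)
  have hlik : ((poissonChannel n u) {y}).toReal = _ := poissonChannel_real_singleton hu y
  simp only [hlik, smul_eq_mul]
  field_simp

lemma hasAffineCondMean_iff_setIntegral [IsFiniteMeasure P] :
    HasAffineCondMean P U Y H c ↔ ∀ (y : Fin n → ℕ) (i : Fin n),
      ∫ ω in Y ⁻¹' {y}, U ω i ∂P =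
        (H *ᵥ (fun j => (y j : ℝ)) + c) i * P.real (Y ⁻¹' {y}) := by
  have hcond {y : Fin n → ℕ} (hy : P (Y ⁻¹' {y}) ≠ 0) (i : Fin n) (m : ℝ) :
      condMean P U Y y i = m ↔ ∫ ω in Y ⁻¹' {y}, U ω i ∂P = m * P.real (Y ⁻¹' {y}) := by
    have hreal : P.real (Y ⁻¹' {y}) ≠ 0 := by rwa [measureReal_ne_zero_iff]
    rw [condMean, ProbabilityTheory.cond, integral_smul_measure, ENNReal.toReal_inv,
      ← measureReal_def, smul_eq_mul, inv_mul_eq_iff_eq_mul₀ hreal, mul_comm m]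
  refine ⟨fun h y i => ?_, fun h y hy => funext fun i => (hcond hy i _).2 (h y i)⟩
  by_cases hy : P (Y ⁻¹' {y}) = 0
  · rw [setIntegral_measure_zero _ hy, measureReal_def, hy, ENNReal.toReal_zero, mul_zero]
  · exact (hcond hy i _).1 (congrFun (h y hy) i)

lemma IsPoissonOutput.exists_pos_preimage_singleton [IsProbabilityMeasure P] (hU : Measurable U)
    (hU0 : ∀ᵐ ω ∂P, ∀ i, 0 ≤ U ω i) (hY : IsPoissonOutput P U Y) (y : Fin n → ℕ) :
    ∃ b : ℝ, 0 < b ∧ P.real (Y ⁻¹' {y}) = b * mixedMoment (zeroOutputPosterior (P.map U)) y ∧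
      ∀ i, ∫ ω in Y ⁻¹' {y}, U ω i ∂P =
        b * mixedMoment (zeroOutputPosterior (P.map U)) (y + Pi.single i 1) := by
  have hnn := ae_nonneg_map hU hU0
  have := Measure.isProbabilityMeasure_map (μ := P) hU.aemeasurable
  have hset {f : (Fin n → ℝ) → ℝ} (hf : Measurable f) :=
    hY.setIntegral_preimage_singleton hU hU0 hf y
  have hZ := integral_exp_pos (integrable_exp_neg_one_dotProduct hnn)
  refine ⟨(∫ u, Real.exp (-1 ⬝ᵥ u) ∂P.map U) / ∏ i, ((y i).factorial : ℝ), by positivity, ?_,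
    fun i => ?_⟩
  · simpa [mixedMoment] using hset (f := fun _ => 1) measurable_const
  · simpa only [mixedMoment, prod_pow_add_single] using hset (measurable_pi_apply i)

lemma IsPoissonOutput.measure_preimage_singleton_ne_zero_iff [IsProbabilityMeasure P]
    (hU : Measurable U) (hU0 : ∀ᵐ ω ∂P, ∀ i, 0 ≤ U ω i) (hY : IsPoissonOutput P U Y)
    (y : Fin n → ℕ) :
    P (Y ⁻¹' {y}) ≠ 0 ↔ mixedMoment (zeroOutputPosterior (P.map U)) y ≠ 0 := by
  obtain ⟨b, hb, hprob, -⟩ := hY.exists_pos_preimage_singleton hU hU0 y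
  rw [← measureReal_ne_zero_iff, hprob, mul_ne_zero_iff_left hb.ne']

theorem IsPoissonOutput.hasAffineCondMean_iff [IsProbabilityMeasure P] (hU : Measurable U)
    (hU0 : ∀ᵐ ω ∂P, ∀ i, 0 ≤ U ω i) (hY : IsPoissonOutput P U Y) :
    HasAffineCondMean P U Y H c ↔
      HasAffineMomentRecursion (zeroOutputPosterior (P.map U)) H c := by
  rw [hasAffineCondMean_iff_setIntegral]
  refine forall_congr' fun y => ?_
  obtain ⟨b, hb, hprob, hmean⟩ := hY.exists_pos_preimage_singleton hU hU0 y
  refine forall_congr' fun i => ?_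
  rw [hprob, hmean, mul_left_comm, mul_right_inj' hb.ne']

lemma covariance_eq_zero_of_ae_eq_const [IsProbabilityMeasure P] {X Z : Ω → ℝ} {k : ℝ}
    (hZ : Z =ᵐ[P] fun _ => k) : cov[X, Z; P] = 0 := by
  refine Eq.trans ?_ (covariance_const_right k (X := X) (μ := P))
  rw [covariance, covariance, integral_congr_ae hZ]
  exact integral_congr_ae (hZ.mono fun ω hω => by simp only [hω])

lemma IsNondegenerate.eq_zero_of_covMatrix_mulVec_eq_zero (hnd : IsNondegenerate P U)
    {v : Fin n → ℝ} (hv : covMatrix P U *ᵥ v = 0) : v = 0 := by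
  have hrange : LinearMap.range (covMatrix P U).mulVecLin = ⊤ :=
    Submodule.eq_top_of_finrank_eq (by simpa [rank] using hnd.2)
  exact LinearMap.injective_iff_surjective.2 (LinearMap.range_eq_top.1 hrange)
    (hv.trans (map_zero _).symm)

lemma IsNondegenerate.isAffinelyNondegenerate_map [IsProbabilityMeasure P] (hU : Measurable U)
    (hnd : IsNondegenerate P U) : IsAffinelyNondegenerate (P.map U) := by
  intro v k hv
  refine hnd.eq_zero_of_covMatrix_mulVec_eq_zero (funext fun i => ?_)
  have hcov : cov[fun ω => U ω i, fun ω => v ⬝ᵥ U ω; P] = 0 :=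
    covariance_eq_zero_of_ae_eq_const (ae_of_ae_map hU.aemeasurable hv)
  simp_rw [dotProduct] at hcov
  rw [covariance_fun_sum_right (fun j => (hnd.1 j).const_mul (v j)) (hnd.1 i)] at hcov
  simp_rw [covariance_const_mul_right, mul_comm (v _)] at hcov
  exact hcov

end Channel

section MainTheorem

variable {Ω : Type*} [MeasurableSpace Ω] {P : Measure Ω} {n : ℕ} {U : Ω → Fin n → ℝ}
  {Y : Ω → Fin n → ℕ} {H : Matrix (Fin n) (Fin n) ℝ} {c θ α : Fin n → ℝ}

lemma HasProductGammaLaw.zeroOutputPosterior_map (hlaw : HasProductGammaLaw P U θ α) :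
    zeroOutputPosterior (P.map U) = piGamma α (1 + θ) := by
  rw [hlaw.2]
  exact zeroOutputPosterior_piGamma (fun i => (hlaw.1 i).2) fun i => (hlaw.1 i).1

lemma HasProductGammaLaw.hasAffineMomentRecursion (hlaw : HasProductGammaLaw P U θ α) :
    HasAffineMomentRecursion (zeroOutputPosterior (P.map U))
      (diagonal fun i => 1 / (1 + θ i)) (fun i => α i / (1 + θ i)) := by
  rw [hlaw.zeroOutputPosterior_map]
  exact hasAffineMomentRecursion_piGamma (fun i => (hlaw.1 i).2)
    fun i => add_pos zero_lt_one (hlaw.1 i).1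

lemma HasProductGammaLaw.mixedMoment_zeroOutputPosterior_ne_zero
    (hlaw : HasProductGammaLaw P U θ α) (y : Fin n → ℕ) :
    mixedMoment (zeroOutputPosterior (P.map U)) y ≠ 0 := by
  rw [hlaw.zeroOutputPosterior_map]
  exact (mixedMoment_piGamma_pos (fun i => (hlaw.1 i).2)
    (fun i => add_pos zero_lt_one (hlaw.1 i).1) y).ne'

theorem IsPoissonOutput.exists_hasAffineCondMean_iff [IsProbabilityMeasure P]
    (hY : IsPoissonOutput P U Y) (hU : Measurable U) (hU0 : ∀ᵐ ω ∂P, ∀ i, 0 ≤ U ω i)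
    (hnd : IsAffinelyNondegenerate (P.map U)) :
    (∃ H c, HasAffineCondMean P U Y H c) ↔ ∃ θ α, HasProductGammaLaw P U θ α := by
  have := Measure.isProbabilityMeasure_map (μ := P) hU.aemeasurable
  simp_rw [hY.hasAffineCondMean_iff hU hU0]
  refine ⟨fun ⟨H, c, hrec⟩ => ?_, fun ⟨θ, α, hlaw⟩ => ⟨_, _, hlaw.hasAffineMomentRecursion⟩⟩
  obtain ⟨a, r, ha, hr, hmap⟩ :=
    exists_eq_piGamma_of_hasAffineMomentRecursion_zeroOutputPosterior (ae_nonneg_map hU hU0) hnd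
      hrec
  exact ⟨r, a, fun i => ⟨hr i, ha i⟩, hmap⟩

theorem HasAffineCondMean.eq_of_hasProductGammaLaw [IsProbabilityMeasure P]
    (h : HasAffineCondMean P U Y H c) (hlaw : HasProductGammaLaw P U θ α) (hU : Measurable U)
    (hU0 : ∀ᵐ ω ∂P, ∀ i, 0 ≤ U ω i) (hY : IsPoissonOutput P U Y) :
    H = (diagonal fun i => 1 / (1 + θ i)) ∧ c = fun i => α i / (1 + θ i) :=
  ((hY.hasAffineCondMean_iff hU hU0).1 h).coeff_unique hlaw.hasAffineMomentRecursion
    hlaw.mixedMoment_zeroOutputPosterior_ne_zero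

end MainTheorem

end PoissonLinear

end

open PoissonLinear in
theorem theorem1_general {Ω : Type*} [MeasurableSpace Ω] (P : Measure Ω)
    [IsProbabilityMeasure P] (n : ℕ)
    (U : Ω → Fin n → ℝ) (Y : Ω → Fin n → ℕ)
    (hU : Measurable U) (hU0 : ∀ᵐ ω ∂P, ∀ i, 0 ≤ U ω i)
    (hY : IsPoissonOutput P U Y)
    (hnd : IsAffinelyNondegenerate (P.map U)) :
    ((∃ (H : Matrix (Fin n) (Fin n) ℝ) (c : Fin n → ℝ),
        HasAffineCondMean P U Y H c) ↔
      ∃ θ α : Fin n → ℝ, HasProductGammaLaw P U θ α) ∧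
    ∀ (H : Matrix (Fin n) (Fin n) ℝ) (c θ α : Fin n → ℝ),
      HasAffineCondMean P U Y H c →
      HasProductGammaLaw P U θ α →
        (∀ y : Fin n → ℕ, P (Y ⁻¹' {y}) ≠ 0) ∧
        H = Matrix.diagonal (fun i => 1 / (1 + θ i)) ∧
        (∀ i, c i = α i * H i i ∧ c i = α i / (1 + θ i)) ∧
        ∀ i, 0 < H i i ∧ H i i < 1 ∧ 0 < c i := by
  refine ⟨hY.exists_hasAffineCondMean_iff hU hU0 hnd, fun H c θ α h hlaw => ?_⟩
  obtain ⟨rfl, rfl⟩ := h.eq_of_hasProductGammaLaw hlaw hU hU0 hY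
  refine ⟨fun y => (hY.measure_preimage_singleton_ne_zero_iff hU hU0 y).2
    (hlaw.mixedMoment_zeroOutputPosterior_ne_zero y), rfl, fun i => ⟨?_, rfl⟩, fun i => ?_⟩
  · rw [Matrix.diagonal_apply_eq, mul_one_div]
  · obtain ⟨hθ, hα⟩ := hlaw.1 i
    have hden : 0 < 1 + θ i := by positivity
    rw [Matrix.diagonal_apply_eq, div_lt_one hden]
    exact ⟨by positivity, by linarith, by positivity⟩

theorem theorem1 {Ω : Type*} [MeasurableSpace Ω] (P : MeasureTheory.Measure Ω)
    [MeasureTheory.IsProbabilityMeasure P] (n : ℕ)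
    (U : Ω → Fin n → ℝ) (Y : Ω → Fin n → ℕ)
    (hU : Measurable U) (hU0 : ∀ᵐ ω ∂P, ∀ i, 0 ≤ U ω i)
    (hY : PoissonLinear.IsPoissonOutput P U Y)
    (hnd : PoissonLinear.IsNondegenerate P U) :
    ((∃ (H : Matrix (Fin n) (Fin n) ℝ) (c : Fin n → ℝ),
        PoissonLinear.HasAffineCondMean P U Y H c) ↔
      ∃ θ α : Fin n → ℝ, PoissonLinear.HasProductGammaLaw P U θ α) ∧
    ∀ (H : Matrix (Fin n) (Fin n) ℝ) (c θ α : Fin n → ℝ),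
      PoissonLinear.HasAffineCondMean P U Y H c →
      PoissonLinear.HasProductGammaLaw P U θ α →
        (∀ y : Fin n → ℕ, P (Y ⁻¹' {y}) ≠ 0) ∧
        H = Matrix.diagonal (fun i => 1 / (1 + θ i)) ∧
        (∀ i, c i = α i * H i i ∧ c i = α i / (1 + θ i)) ∧
        ∀ i, 0 < H i i ∧ H i i < 1 ∧ 0 < c i :=
  theorem1_general P n U Y hU hU0 hY (hnd.isAffinelyNondegenerate_map hU)
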